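/- For $r\ge 1$ let $H_{r,3}=\sum_{s=1}^{r}\frac{1}{s^{3}}$ be the generalized harmonic number of order $3$, and let $\zeta$ be the Riemann zeta function. Then the series $\sum_{r=1}^{\infty}\frac{H_{r,3}^{2}}{r(r+1)}$ converges and $$\sum_{r=1}^{\infty}\frac{H_{r,3}^{2}}{r(r+1)}=35\,\zeta(7)-\frac{10\pi^{2}}{3}\,\zeta(5).$$ -/

import Mathlib

/-- The generalized harmonic number `H_{N,m} = ∑_{s=1}^N 1 / s^m` of complex order `m`. -/
noncomputable def genHarmonic (N : ℕ) (m : ℂ) : ℂ :=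
  ∑ s ∈ Finset.Icc 1 N, 1 / (s : ℂ) ^ m

open Finset Filter Topology

/-! Since 1/(r(r+1)) = 1/r - 1/(r+1), summation by parts turns the series into 2 ∑ H_r/r⁴ - ζ(7) =
2ζ(4,3) + ζ(7), where ζ(a,b) is `doubleZeta a b`. It remains to find ζ(4,3). In weight 7, the
stuffle and shuffle expansions of ζ(2)ζ(5) and ζ(3)ζ(4), with Euler's sum formula, are five linear
relations; eliminating the other double zetas and ζ(3)ζ(4) leaves ζ(4,3) = 17ζ(7) - 10ζ(2)ζ(5). Then
ζ(2) = π²/6. Working in `ENNReal` lets double series be rearranged freely; finiteness is read off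
afterwards. -/

/-- The `n`-th term of the zeta series, `1 / (n + 1) ^ a`, as an extended nonnegative real. -/
noncomputable def zetaTerm (a n : ℕ) : ENNReal := ENNReal.ofReal (1 / ((n : ℝ) + 1) ^ a)

/-- The zeta value `ζ(a)` as an extended nonnegative real. -/
noncomputable def zetaSum (a : ℕ) : ENNReal := ∑' n, zetaTerm a n

/-- The double zeta value `∑_{n > m ≥ 1} 1 / (n ^ a * m ^ b)` as an extended nonnegative real. -/
noncomputable def doubleZeta (a b : ℕ) : ENNReal :=
  ∑' m : ℕ, ∑' k : ℕ, zetaTerm b m * zetaTerm a (m + k + 1)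

/-! ### Double series and the stuffle product -/

theorem tsum_ite_lt (F : ℕ → ENNReal) (m : ℕ) :
    (∑' n, if m < n then F n else 0) = ∑' k, F (m + k + 1) := by
  rw [← Summable.sum_add_tsum_nat_add' (k := m + 1) ENNReal.summable]
  rw [Finset.sum_eq_zero, zero_add]
  · refine tsum_congr fun k => ?_
    rw [if_pos (by omega)]
    congr 1
    omega
  · intro i hi
    rw [if_neg (by have := Finset.mem_range.1 hi; omega)]

theorem tsum_tsum_ite_lt (F G : ℕ → ENNReal) :
    (∑' n, ∑' m, if m < n then F n * G m else 0) = ∑' m, ∑' k, G m * F (m + k + 1) := by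
  rw [ENNReal.tsum_comm]
  refine tsum_congr fun m => ?_
  rw [tsum_ite_lt (fun n => F n * G m) m]
  exact tsum_congr fun k => mul_comm _ _

theorem tsum_mul_sum_range_succ (F G : ℕ → ENNReal) :
    (∑' n, F n * ∑ i ∈ range (n + 1), G i) =
      (∑' m, ∑' k, G m * F (m + k + 1)) + ∑' n, F n * G n := by
  rw [← tsum_tsum_ite_lt, ← ENNReal.tsum_add]
  refine tsum_congr fun n => ?_
  rw [sum_range_succ, mul_add, mul_sum, tsum_eq_sum (s := range n)]
  · congr 1
    exact sum_congr rfl fun i hi => by rw [if_pos (Finset.mem_range.1 hi)]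
  · intro i hi
    rw [if_neg (by simpa using hi)]

theorem zetaTerm_mul_zetaTerm (a b n : ℕ) :
    zetaTerm a n * zetaTerm b n = zetaTerm (a + b) n := by
  rw [zetaTerm, zetaTerm, zetaTerm, ← ENNReal.ofReal_mul (by positivity), pow_add,
    one_div_mul_one_div]

/-- The stuffle (quasi-shuffle) product of two zeta values. -/
theorem zetaSum_mul_zetaSum (a b : ℕ) :
    zetaSum a * zetaSum b = doubleZeta a b + doubleZeta b a + zetaSum (a + b) := by
  have h1 : zetaSum a * zetaSum b = ∑' n, ∑' m, zetaTerm a n * zetaTerm b m := by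
    simp_rw [zetaSum, ENNReal.tsum_mul_left, ENNReal.tsum_mul_right]
  have h2 : zetaSum (a + b) = ∑' n, ∑' m, if m = n then zetaTerm a n * zetaTerm b m else 0 := by
    refine tsum_congr fun n => ?_
    rw [tsum_ite_eq, zetaTerm_mul_zetaTerm]
  have h3 : doubleZeta b a = ∑' n, ∑' m, if n < m then zetaTerm a n * zetaTerm b m else 0 := by
    rw [doubleZeta]
    exact tsum_congr fun n => (tsum_ite_lt (fun m => zetaTerm a n * zetaTerm b m) n).symm
  rw [h1, h2, h3, doubleZeta, ← tsum_tsum_ite_lt]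
  simp_rw [← ENNReal.tsum_add]
  refine tsum_congr fun n => tsum_congr fun m => ?_
  rcases lt_trichotomy m n with h | h | h
  · simp [h, h.ne, h.not_gt]
  · simp [h]
  · simp [h, h.ne', h.not_gt]

/-- With x = m + 1 and y = k + 1 the larger index is x + y, symmetric in x and y, so either may
serve as the smaller index. -/
theorem doubleZeta_swap (a b : ℕ) :
    doubleZeta a b = ∑' m : ℕ, ∑' k : ℕ, zetaTerm b k * zetaTerm a (m + k + 1) := by
  rw [ENNReal.tsum_comm, doubleZeta]
  simp_rw [add_comm]

theorem zetaTerm_mul_shift (b a m k : ℕ) (i : ℕ) :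
    zetaTerm b i * zetaTerm a (m + k + 1) =
      ENNReal.ofReal (1 / (((i : ℝ) + 1) ^ b * (((m : ℝ) + 1) + (k + 1)) ^ a)) := by
  rw [zetaTerm, zetaTerm, ← ENNReal.ofReal_mul (by positivity), one_div_mul_one_div]
  congr 4
  push_cast
  ring

/-- Shuffle product: the partial fraction expansion of 1/(x²y⁵) in powers of 1/(x + y) times powers
of 1/x or 1/y, summed over x and y. -/
theorem zetaSum_two_mul_zetaSum_five :
    zetaSum 2 * zetaSum 5 = doubleZeta 2 5 + 2 * doubleZeta 3 4 + 3 * doubleZeta 4 3 +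
      4 * doubleZeta 5 2 + 5 * doubleZeta 6 1 + (doubleZeta 5 2 + 5 * doubleZeta 6 1) := by
  have h1 : zetaSum 2 * zetaSum 5 = ∑' n, ∑' m, zetaTerm 2 n * zetaTerm 5 m := by
    simp_rw [zetaSum, ENNReal.tsum_mul_left, ENNReal.tsum_mul_right]
  rw [h1, doubleZeta_swap 2 5, doubleZeta_swap 3 4, doubleZeta_swap 4 3]
  -- Only the first copies are swapped: they carry the powers of 1/y, the bracketed ones those of
  -- 1/x.
  nth_rw 1 [doubleZeta_swap 5 2, doubleZeta_swap 6 1]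
  rw [doubleZeta, doubleZeta]
  simp_rw [← ENNReal.tsum_mul_left, ← ENNReal.tsum_add]
  refine tsum_congr fun m => tsum_congr fun k => ?_
  simp_rw [zetaTerm_mul_shift]
  rw [zetaTerm, zetaTerm, ← ENNReal.ofReal_mul (by positivity),
    ← ENNReal.ofReal_ofNat 2, ← ENNReal.ofReal_ofNat 3, ← ENNReal.ofReal_ofNat 4,
    ← ENNReal.ofReal_ofNat 5]
  have hx : (0 : ℝ) < m + 1 := by positivity
  have hy : (0 : ℝ) < k + 1 := by positivity
  generalize (m : ℝ) + 1 = x at hx ⊢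
  generalize (k : ℝ) + 1 = y at hy ⊢
  repeat rw [← ENNReal.ofReal_mul (by positivity)]
  repeat rw [← ENNReal.ofReal_add (by positivity) (by positivity)]
  congr 1
  field_simp
  ring

theorem zetaSum_three_mul_zetaSum_four :
    zetaSum 3 * zetaSum 4 = doubleZeta 3 4 + 3 * doubleZeta 4 3 + 6 * doubleZeta 5 2 +
      10 * doubleZeta 6 1 + (doubleZeta 4 3 + 4 * doubleZeta 5 2 + 10 * doubleZeta 6 1) := by
  have h1 : zetaSum 3 * zetaSum 4 = ∑' n, ∑' m, zetaTerm 3 n * zetaTerm 4 m := by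
    simp_rw [zetaSum, ENNReal.tsum_mul_left, ENNReal.tsum_mul_right]
  rw [h1, doubleZeta_swap 3 4]
  nth_rw 1 [doubleZeta_swap 4 3, doubleZeta_swap 5 2, doubleZeta_swap 6 1]
  rw [doubleZeta, doubleZeta, doubleZeta]
  simp_rw [← ENNReal.tsum_mul_left, ← ENNReal.tsum_add]
  refine tsum_congr fun m => tsum_congr fun k => ?_
  simp_rw [zetaTerm_mul_shift]
  rw [zetaTerm, zetaTerm, ← ENNReal.ofReal_mul (by positivity),
    ← ENNReal.ofReal_ofNat 3, ← ENNReal.ofReal_ofNat 4, ← ENNReal.ofReal_ofNat 6,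
    ← ENNReal.ofReal_ofNat 10]
  have hx : (0 : ℝ) < m + 1 := by positivity
  have hy : (0 : ℝ) < k + 1 := by positivity
  generalize (m : ℝ) + 1 = x at hx ⊢
  generalize (k : ℝ) + 1 = y at hy ⊢
  repeat rw [← ENNReal.ofReal_mul (by positivity)]
  repeat rw [← ENNReal.ofReal_add (by positivity) (by positivity)]
  congr 1
  field_simp
  ring

/-! ### Telescoping and the sum formula -/

theorem hasSum_sub_succ_of_antitone {f : ℕ → ℝ} (hf : Antitone f) (h0 : Tendsto f atTop (𝓝 0)) :
    HasSum (fun n => f n - f (n + 1)) (f 0) := by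
  rw [hasSum_iff_tendsto_nat_of_nonneg fun n => sub_nonneg.2 (hf n.le_succ)]
  simp_rw [Finset.sum_range_sub']
  simpa using h0.const_sub (f 0)

theorem hasSum_one_div_sub_one_div (m : ℕ) :
    HasSum (fun k : ℕ => 1 / ((k : ℝ) + 1) - 1 / ((m : ℝ) + k + 1))
      (∑ i ∈ range m, 1 / ((i : ℝ) + 1)) := by
  induction m with
  | zero => simp
  | succ m ih =>
    rw [sum_range_succ]
    have h : HasSum (fun k : ℕ => 1 / ((m : ℝ) + k + 1) - 1 / ((m : ℝ) + (k + 1 : ℕ) + 1))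
        (1 / ((m : ℝ) + (0 : ℕ) + 1)) := by
      refine hasSum_sub_succ_of_antitone (f := fun k : ℕ => 1 / ((m : ℝ) + k + 1)) ?_ ?_
      · intro a b hab
        have : (a : ℝ) ≤ b := by exact_mod_cast hab
        dsimp only
        gcongr
      · have := (tendsto_add_atTop_iff_nat m).2 (tendsto_one_div_add_atTop_nhds_zero_nat (𝕜 := ℝ))
        refine this.congr fun k => ?_
        push_cast
        ring_nf
    convert ih.add h using 1
    · ext k
      push_cast
      ring
    · simp

theorem tsum_one_div_mul_add (m : ℕ) :
    (∑' k : ℕ, ENNReal.ofReal (1 / (((m : ℝ) + 1) ^ 5 * ((k : ℝ) + 1) * (((m : ℝ) + 1) + (k + 1)))))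
      = zetaTerm 6 m * ∑ i ∈ range (m + 1), zetaTerm 1 i := by
  have h := (hasSum_one_div_sub_one_div (m + 1)).mul_left (1 / ((m : ℝ) + 1) ^ 6)
  have h' : (fun k : ℕ => 1 / ((m : ℝ) + 1) ^ 6 *
      (1 / ((k : ℝ) + 1) - 1 / (((m + 1 : ℕ) : ℝ) + k + 1))) =
      fun k : ℕ => 1 / (((m : ℝ) + 1) ^ 5 * ((k : ℝ) + 1) * (((m : ℝ) + 1) + (k + 1))) := by
    ext k
    have hx : (0 : ℝ) < m + 1 := by positivity
    push_cast
    field_simp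
    ring
  rw [h'] at h
  rw [← ENNReal.ofReal_tsum_of_nonneg (fun k => by positivity) h.summable, h.tsum_eq,
    ENNReal.ofReal_mul (by positivity), ENNReal.ofReal_sum_of_nonneg (fun i _ => by positivity)]
  simp [zetaTerm]

/-- Euler's sum formula, with ζ(6,1) left on both sides because `ENNReal` does not cancel. Both
sides sum 1/(x⁵y(x + y)): repeated use of 1/(xy) = (1/x + 1/y)/(x + y) gives the left, telescoping
over y gives ∑ H_x/x⁶, the right. -/
theorem sum_doubleZeta_add_doubleZeta :
    doubleZeta 2 5 + doubleZeta 3 4 + doubleZeta 4 3 + doubleZeta 5 2 + doubleZeta 6 1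
      + doubleZeta 6 1 = doubleZeta 6 1 + zetaSum 7 := by
  have h : doubleZeta 6 1 + zetaSum 7 = ∑' m : ℕ, ∑' k : ℕ,
      ENNReal.ofReal (1 / (((m : ℝ) + 1) ^ 5 * ((k : ℝ) + 1) * (((m : ℝ) + 1) + (k + 1)))) := by
    simp_rw [tsum_one_div_mul_add, tsum_mul_sum_range_succ, zetaTerm_mul_zetaTerm]
    rfl
  rw [h]
  nth_rw 2 [doubleZeta_swap 6 1]
  simp_rw [doubleZeta, ← ENNReal.tsum_add]
  refine tsum_congr fun m => tsum_congr fun k => ?_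
  simp_rw [zetaTerm_mul_shift]
  have hx : (0 : ℝ) < m + 1 := by positivity
  have hy : (0 : ℝ) < k + 1 := by positivity
  generalize (m : ℝ) + 1 = x at hx ⊢
  generalize (k : ℝ) + 1 = y at hy ⊢
  repeat rw [← ENNReal.ofReal_add (by positivity) (by positivity)]
  congr 1
  field_simp
  ring

/-! ### Finiteness and the value of ζ(4,3) -/

theorem summable_one_div_add_one_pow {a : ℕ} (ha : 1 < a) :
    Summable fun n : ℕ => 1 / ((n : ℝ) + 1) ^ a := by
  simpa using (summable_nat_add_iff 1).2 (Real.summable_one_div_nat_pow.2 ha)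

theorem zetaSum_eq_ofReal {a : ℕ} (ha : 1 < a) :
    zetaSum a = ENNReal.ofReal (∑' n : ℕ, 1 / ((n : ℝ) + 1) ^ a) :=
  (ENNReal.ofReal_tsum_of_nonneg (fun n => by positivity) (summable_one_div_add_one_pow ha)).symm

theorem zetaSum_ne_top {a : ℕ} (ha : 1 < a) : zetaSum a ≠ ⊤ := by
  rw [zetaSum_eq_ofReal ha]
  exact ENNReal.ofReal_ne_top

theorem ofReal_toReal_zetaSum {a : ℕ} (ha : 1 < a) :
    ((zetaSum a).toReal : ℂ) = riemannZeta a := by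
  rw [zetaSum_eq_ofReal ha, ENNReal.toReal_ofReal (tsum_nonneg fun n => by positivity),
    zeta_eq_tsum_one_div_nat_add_one_cpow (by simpa using ha)]
  push_cast
  simp [Complex.cpow_natCast]

theorem doubleZeta_four_three :
    doubleZeta 4 3 ≠ ⊤ ∧ (doubleZeta 4 3).toReal =
      17 * (zetaSum 7).toReal - 10 * ((zetaSum 2).toReal * (zetaSum 5).toReal) := by
  have z2 := zetaSum_ne_top (a := 2) (by norm_num)
  have z3 := zetaSum_ne_top (a := 3) (by norm_num)
  have z4 := zetaSum_ne_top (a := 4) (by norm_num)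
  have z5 := zetaSum_ne_top (a := 5) (by norm_num)
  have z7 := zetaSum_ne_top (a := 7) (by norm_num)
  have e1 := zetaSum_mul_zetaSum 2 5
  have e2 := zetaSum_mul_zetaSum 3 4
  have e3 := zetaSum_two_mul_zetaSum_five
  have e4 := zetaSum_three_mul_zetaSum_four
  have e5 := sum_doubleZeta_add_doubleZeta
  have f1 := ENNReal.mul_ne_top z2 z5
  have f2 := ENNReal.mul_ne_top z3 z4
  have f3 := f1
  rw [e1] at f1
  rw [e2] at f2
  rw [e3] at f3
  -- Each double zeta is a summand of a finite product of zeta values; ζ(6,1) occurs only in the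
  -- shuffle expansion.
  simp only [ne_eq, ENNReal.add_eq_top, not_or] at f1 f2 f3
  have d25 : doubleZeta 2 5 ≠ ⊤ := f1.1.1
  have d52 : doubleZeta 5 2 ≠ ⊤ := f1.1.2
  have d34 : doubleZeta 3 4 ≠ ⊤ := f2.1.1
  have d43 : doubleZeta 4 3 ≠ ⊤ := f2.1.2
  have d61 : doubleZeta 6 1 ≠ ⊤ := fun h => f3.2.2 (by rw [h, ENNReal.mul_top (by norm_num)])
  refine ⟨d43, ?_⟩
  norm_num at e1 e2
  lift zetaSum 2 to NNReal using z2 with Z2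
  lift zetaSum 3 to NNReal using z3 with Z3
  lift zetaSum 4 to NNReal using z4 with Z4
  lift zetaSum 5 to NNReal using z5 with Z5
  lift zetaSum 7 to NNReal using z7 with Z7
  lift doubleZeta 2 5 to NNReal using d25 with D25
  lift doubleZeta 5 2 to NNReal using d52 with D52
  lift doubleZeta 3 4 to NNReal using d34 with D34
  lift doubleZeta 4 3 to NNReal using d43 with D43
  lift doubleZeta 6 1 to NNReal using d61 with D61
  norm_cast at e1 e2 e3 e4 e5
  rw [← NNReal.coe_inj] at e1 e2 e3 e4 e5
  push_cast at e1 e2 e3 e4 e5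
  simp only [ENNReal.coe_toReal]
  linarith

/-- The real generalized harmonic number `∑_{i ≤ n} 1 / (i + 1) ^ 3`. -/
noncomputable def cubicHarmonic (n : ℕ) : ℝ := ∑ i ∈ range (n + 1), 1 / ((i : ℝ) + 1) ^ 3

theorem hasSum_cubicHarmonic_div :
    HasSum (fun n : ℕ => cubicHarmonic n / ((n : ℝ) + 1) ^ 4)
      ((doubleZeta 4 3).toReal + (zetaSum 7).toReal) := by
  have h := tsum_mul_sum_range_succ (zetaTerm 4) (zetaTerm 3)
  simp_rw [zetaTerm_mul_zetaTerm] at h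
  change _ = doubleZeta 4 3 + zetaSum 7 at h
  have z7 := zetaSum_ne_top (a := 7) (by norm_num)
  have d43 := doubleZeta_four_three.1
  have hs := ENNReal.hasSum_toReal (h.trans_ne (ENNReal.add_ne_top.2 ⟨d43, z7⟩))
  rw [← ENNReal.tsum_toReal_eq (ENNReal.ne_top_of_tsum_ne_top
    (h.trans_ne (ENNReal.add_ne_top.2 ⟨d43, z7⟩))), h, ENNReal.toReal_add d43 z7] at hs
  convert hs using 2 with n
  simp_rw [zetaTerm]
  rw [← ENNReal.ofReal_sum_of_nonneg fun i _ => by positivity,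
    ← ENNReal.ofReal_mul (by positivity), ENNReal.toReal_ofReal
      (mul_nonneg (by positivity) (sum_nonneg fun i _ => by positivity)), cubicHarmonic]
  ring

/-- Summation by parts, using H_r² - H_{r-1}² = 2H_r/r³ - 1/r⁶; the subtracted fraction is the
boundary term at r = N + 1. -/
theorem sum_range_cubicHarmonic_sq (N : ℕ) :
    ∑ n ∈ range (N + 1), cubicHarmonic n ^ 2 / (((n : ℝ) + 1) * ((n : ℝ) + 1 + 1)) =
      ∑ n ∈ range (N + 1), (2 * (cubicHarmonic n / ((n : ℝ) + 1) ^ 4) - 1 / ((n : ℝ) + 1) ^ 7) -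
        cubicHarmonic N ^ 2 / ((N : ℝ) + 2) := by
  induction N with
  | zero => norm_num [cubicHarmonic]
  | succ N ih =>
    rw [sum_range_succ, ih, sum_range_succ _ (N + 1)]
    have h : cubicHarmonic N = cubicHarmonic (N + 1) - 1 / ((N : ℝ) + 1 + 1) ^ 3 := by
      simp [cubicHarmonic, sum_range_succ _ (N + 1)]
    rw [h]
    push_cast
    field_simp
    ring

theorem hasSum_cubicHarmonic_sq :
    HasSum (fun n : ℕ => cubicHarmonic n ^ 2 / (((n : ℝ) + 1) * ((n : ℝ) + 1 + 1)))
      (35 * (zetaSum 7).toReal - 20 * ((zetaSum 2).toReal * (zetaSum 5).toReal)) := by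
  rw [hasSum_iff_tendsto_nat_of_nonneg fun n => by positivity, ← tendsto_add_atTop_iff_nat 1]
  simp_rw [sum_range_cubicHarmonic_sq]
  have h7 : HasSum (fun n : ℕ => 1 / ((n : ℝ) + 1) ^ 7) (zetaSum 7).toReal := by
    have hs := summable_one_div_add_one_pow (a := 7) (by norm_num)
    rw [zetaSum_eq_ofReal (by norm_num), ENNReal.toReal_ofReal (tsum_nonneg fun n => by positivity)]
    exact hs.hasSum
  have h1 := (tendsto_add_atTop_iff_nat 1).2
    ((hasSum_cubicHarmonic_div.mul_left 2).sub h7).tendsto_sum_nat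
  have h3 : Tendsto cubicHarmonic atTop (𝓝 (∑' i : ℕ, 1 / ((i : ℝ) + 1) ^ 3)) :=
    (tendsto_add_atTop_iff_nat 1).2
      (summable_one_div_add_one_pow (a := 3) (by norm_num)).hasSum.tendsto_sum_nat
  -- The boundary term vanishes because H_r converges.
  have h4 : Tendsto (fun N : ℕ => cubicHarmonic N ^ 2 / ((N : ℝ) + 2)) atTop (𝓝 0) :=
    (h3.pow 2).div_atTop (tendsto_atTop_add_const_right _ _ tendsto_natCast_atTop_atTop)
  convert h1.sub h4 using 2
  rw [doubleZeta_four_three.2]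
  ring

theorem genHarmonic_three_succ (n : ℕ) : genHarmonic (n + 1) 3 = cubicHarmonic n := by
  have h : ∀ z : ℂ, z ^ (3 : ℂ) = z ^ 3 := fun z => by exact_mod_cast Complex.cpow_natCast z 3
  induction n with
  | zero => simp [genHarmonic, cubicHarmonic]
  | succ n ih =>
    rw [genHarmonic, sum_Icc_succ_top (by omega), ← genHarmonic, ih, cubicHarmonic, cubicHarmonic,
      sum_range_succ _ (n + 1), h]
    push_cast
    rfl

theorem mainTheorem5 :
    HasSum (fun r : ℕ+ => genHarmonic (r : ℕ) 3 ^ 2 / ((r : ℂ) * ((r : ℂ) + 1)))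
      (35 * riemannZeta 7 - 10 * (Real.pi : ℂ) ^ 2 / 3 * riemannZeta 5) := by
  have h := Complex.hasSum_ofReal.2 hasSum_cubicHarmonic_sq
  rw [← Equiv.pnatEquivNat.symm.hasSum_iff]
  convert h using 1
  · ext n
    simp [genHarmonic_three_succ]
  · have h2 := ofReal_toReal_zetaSum (a := 2) (by norm_num)
    have h5 := ofReal_toReal_zetaSum (a := 5) (by norm_num)
    have h7 := ofReal_toReal_zetaSum (a := 7) (by norm_num)
    push_cast at h2 h5 h7 ⊢
    rw [h2, h5, h7, riemannZeta_two]
    ring
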